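/- Let $N\ge 3$ and let $d_1\ge d_2\ge\dots\ge d_N$ be integers, $d_i\ge 1$, with $d_1\ge 10$ and $d_2\ge 4$. A product state in $\mathbb{C}^{d_1}\otimes\cdots\otimes\mathbb{C}^{d_N}$ is a vector $v_1\otimes\cdots\otimes v_N$ with unit vectors $v_i\in\mathbb{C}^{d_i}$. An unextendible product basis (UPB) of this space is a family of $k<\prod_{i=1}^N d_i$ pairwise orthogonal product states such that no product state is orthogonal to all of them; its missing states number is $\prod_{i=1}^N d_i-k$. Then for every integer $s$ with $$4\le s\le (d_1-8)(d_2-1)\prod_{i=3}^{N}d_i$$ there is a UPB in $\mathbb{C}^{d_1}\otimes\cdots\otimes\mathbb{C}^{d_N}$ whose missing states number is $s$. -/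

import Mathlib

/-- The Hilbert space `ℂ^{d 0} ⊗ ⋯ ⊗ ℂ^{d (N-1)}` of an `N`-partite system, in coordinates:
an amplitude for each vector `|x 0, …, x (N-1)⟩` of the product basis, with the standard
Hermitian inner product. -/
abbrev MultipartiteSpace {N : ℕ} (d : Fin N → ℕ) : Type :=
  EuclideanSpace ℂ ((i : Fin N) → Fin (d i))

/-- The elementary tensor `v 0 ⊗ ⋯ ⊗ v (N-1)`. -/
noncomputable def tensorVector {N : ℕ} {d : Fin N → ℕ}
    (v : (i : Fin N) → EuclideanSpace ℂ (Fin (d i))) : MultipartiteSpace d :=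
  WithLp.toLp 2 (fun x => ∏ i, v i (x i))

/-- The inner product of elementary tensors is the product of the local inner products. -/
theorem inner_tensorVector {N : ℕ} {d : Fin N → ℕ}
    (v w : (i : Fin N) → EuclideanSpace ℂ (Fin (d i))) :
    inner ℂ (tensorVector v) (tensorVector w) = ∏ i, inner ℂ (v i) (w i) := by
  simp only [tensorVector, PiLp.inner_apply, RCLike.inner_apply, map_prod]
  rw [Finset.prod_univ_sum, Fintype.piFinset_univ]
  exact Finset.sum_congr rfl (fun x _ => Finset.prod_mul_distrib.symm)

/-- Tensoring vectors of the standard local bases gives the standard product basis. -/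
theorem tensorVector_single {N : ℕ} {d : Fin N → ℕ} (x : (i : Fin N) → Fin (d i)) :
    tensorVector (fun i => EuclideanSpace.single (x i) (1 : ℂ)) =
      (EuclideanSpace.single x (1 : ℂ) : MultipartiteSpace d) := by
  ext y
  by_cases h : y = x
  · subst h
    simp [tensorVector]
  · obtain ⟨i, hi⟩ := Function.ne_iff.mp h
    have h0 : ∏ j, (EuclideanSpace.single (x j) (1 : ℂ)) (y j) = 0 :=
      Finset.prod_eq_zero (Finset.mem_univ i) (by simp [hi])
    simpa [tensorVector, h] using h0

/-- A (pure, normalized) product state: a tensor product of unit vectors of the local spaces. -/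
def IsProductState {N : ℕ} {d : Fin N → ℕ} (ψ : MultipartiteSpace d) : Prop :=
  ∃ v : (i : Fin N) → EuclideanSpace ℂ (Fin (d i)), (∀ i, ‖v i‖ = 1) ∧ ψ = tensorVector v

/-- A `k`-member unextendible product basis (UPB) of `ℂ^{d 0} ⊗ ⋯ ⊗ ℂ^{d (N-1)}`. -/
structure IsUPB {N : ℕ} (d : Fin N → ℕ) {k : ℕ} (φ : Fin k → MultipartiteSpace d) : Prop where
  card_lt : k < ∏ i, d i
  isProductState : ∀ j, IsProductState (φ j)
  orthonormal : Orthonormal ℂ φ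
  unextendible : ∀ ψ : MultipartiteSpace d, (∀ j, inner ℂ (φ j) ψ = 0) → ¬ IsProductState ψ

/-- There is a UPB whose missing states number (dimension minus number of members) is `s`. -/
def HasUPBWithMissingNumber {N : ℕ} (d : Fin N → ℕ) (s : ℕ) : Prop :=
  ∃ (k : ℕ) (φ : Fin k → MultipartiteSpace d), IsUPB d φ ∧ k + s = ∏ i, d i

/-! Everything reduces to two factors. Attach to each standard basis vector of the last `N - 2`
factors an unextendible family of the first two. The union is unextendible and the missing numbers
add (`hasUPBWithMissingNumber_sum`). A zero missing number is always available, so it suffices to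
realise all of `[4, K]` with `K = max 7 ((d 0 - 8) * (d 1 - 1))`. Such numbers, with 0, sum to every
required `s`.

For two factors, splitting one factor as a direct sum again adds missing numbers, so small families
serve as blocks. The large blocks are minimal families of `k = p + n - 1` vectors in `ℂ^p ⊗ ℂ^n`,
missing `(p - 1) * (n - 1)`. Their local vectors are weighted Fourier vectors `√(a x) α^(j x)`. By a
Vandermonde argument a nonzero `f` is orthogonal to at most `p - 1` of them and a nonzero `g` to at
most `n - 1`, so some member is orthogonal to neither. The inner product of members `j` and `j + δ`
is the polynomial with coefficients `a` at `α^δ`. Hence one needs polynomials with positive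
coefficients, of degrees `p - 1` and `n - 1`, whose zeros together account for every `0 < δ < k`.

Take `α` and `β` to be `k`-th roots of unity. One polynomial vanishes at the `δ` within `t` of 0
modulo `k`, the other at the middle ones. Both come from Gaussian binomials, and a suitable
primitive root `exp (2 π i u / k)` makes the coefficients positive. A power of two serves as `u`
when both dimensions are odd; a Bertrand prime serves for an even dimension, at the cost of possibly
widening the block by 2. -/

/-- `ℂ^α ⊗ ℂ^β` has an orthogonal family of nonzero product vectors, `s` fewer than the dimension,
such that no nonzero product vector is orthogonal to all of them. -/
def UnextendibleMissing (α β : Type) [Fintype α] [Fintype β] (s : ℕ) : Prop :=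
  ∃ (ι : Type) (_ : Fintype ι) (v : ι → α → ℂ) (w : ι → β → ℂ),
    (∀ j, v j ≠ 0) ∧ (∀ j, w j ≠ 0) ∧
    (∀ j l, j ≠ l → star (v j) ⬝ᵥ v l = 0 ∨ star (w j) ⬝ᵥ w l = 0) ∧
    (∀ f g, f ≠ 0 → g ≠ 0 → ∃ j, star (v j) ⬝ᵥ f ≠ 0 ∧ star (w j) ⬝ᵥ g ≠ 0) ∧
    Fintype.card ι + s = Fintype.card α * Fintype.card β

/-- The same for `ℂ^m ⊗ ℂ^n`. -/
def BipartiteMissing (m n s : ℕ) : Prop := UnextendibleMissing (Fin m) (Fin n) s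

/-! ### Direct sums of bipartite families -/

namespace UnextendibleMissing

variable {α α' β β' : Type} [Fintype α] [Fintype α'] [Fintype β] [Fintype β'] {s s' : ℕ}

theorem swap (h : UnextendibleMissing α β s) : UnextendibleMissing β α s := by
  obtain ⟨ι, _, v, w, hv, hw, ho, hu, hc⟩ := h
  refine ⟨ι, inferInstance, w, v, hw, hv, fun j l hjl => (ho j l hjl).symm, fun f g hf hg => ?_, ?_⟩
  · obtain ⟨j, h1, h2⟩ := hu g f hg hf
    exact ⟨j, h2, h1⟩
  · rw [hc, mul_comm]

theorem congr_left (e : α ≃ α') (h : UnextendibleMissing α β s) : UnextendibleMissing α' β s := by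
  obtain ⟨ι, _, v, w, hv, hw, ho, hu, hc⟩ := h
  refine ⟨ι, inferInstance, fun j => v j ∘ e.symm, w, fun j hj => hv j ?_, hw, fun j l hjl => ?_,
    fun f g hf hg => ?_, ?_⟩
  · funext x
    simpa using congrFun hj (e x)
  · rcases ho j l hjl with h | h
    · left
      rw [← h]
      exact dotProduct_comp_equiv_symm (star (v j) ∘ e.symm) (v l) e |>.trans (by
        congr 1; funext x; simp)
    · exact Or.inr h
  · obtain ⟨j, h1, h2⟩ := hu (f ∘ e) g (fun h => hf (by
      funext x; simpa using congrFun h (e.symm x))) hg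
    refine ⟨j, ?_, h2⟩
    have := comp_equiv_symm_dotProduct (star (v j)) f e
    rw [← this] at h1
    exact h1
  · rw [hc, Fintype.card_congr e]

/-- Members from different summands have disjoint supports on the left. A nonzero `f` has a nonzero
restriction to one summand, where that summand's family already detects it. -/
theorem sum_left (h : UnextendibleMissing α β s) (h' : UnextendibleMissing α' β s') :
    UnextendibleMissing (α ⊕ α') β (s + s') := by
  obtain ⟨ι, _, v, w, hv, hw, ho, hu, hc⟩ := h
  obtain ⟨ι', _, v', w', hv', hw', ho', hu', hc'⟩ := h'
  have hs : ∀ (a : α → ℂ) (b : α' → ℂ), star (Sum.elim a b) = Sum.elim (star a) (star b) := by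
    intro a b; funext x; cases x <;> rfl
  have hd : ∀ (a : α → ℂ) (b : α' → ℂ) (f : α ⊕ α' → ℂ), Sum.elim a b ⬝ᵥ f =
      a ⬝ᵥ (f ∘ Sum.inl) + b ⬝ᵥ (f ∘ Sum.inr) := by
    intro a b f
    simp [dotProduct]
  refine ⟨ι ⊕ ι', inferInstance, Sum.elim (fun j => Sum.elim (v j) 0) (fun j => Sum.elim 0 (v' j)),
    Sum.elim w w', ?_, ?_, ?_, ?_, ?_⟩
  · rintro (j | j) h
    · exact hv j (by funext x; simpa using congrFun h (Sum.inl x))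
    · exact hv' j (by funext x; simpa using congrFun h (Sum.inr x))
  · rintro (j | j)
    · exact hw j
    · exact hw' j
  · rintro (j | j) (l | l) hjl
    · simpa [hs] using ho j l (by simpa using hjl)
    · simp [hs]
    · simp [hs]
    · simpa [hs] using ho' j l (by simpa using hjl)
  · intro f g hf hg
    by_cases h : f ∘ Sum.inl = 0
    · obtain ⟨j, h1, h2⟩ := hu' (f ∘ Sum.inr) g (fun h0 => hf (by
        funext x
        rcases x with x | x
        · exact congrFun h x
        · exact congrFun h0 x)) hg
      exact ⟨Sum.inr j, by simpa [hs, hd] using h1, h2⟩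
    · obtain ⟨j, h1, h2⟩ := hu (f ∘ Sum.inl) g h hg
      exact ⟨Sum.inl j, by simpa [hs, hd] using h1, h2⟩
  · simp only [Fintype.card_sum, add_mul]
    omega

theorem zero (α β : Type) [Fintype α] [Fintype β] : UnextendibleMissing α β 0 := by
  classical
  refine ⟨α × β, inferInstance, fun x => Pi.single x.1 1, fun x => Pi.single x.2 1, ?_, ?_, ?_, ?_,
    by simp⟩
  · intro j; simp
  · intro j; simp
  · rintro ⟨a, b⟩ ⟨c, d⟩ h
    by_cases hac : a = c
    · right
      have : b ≠ d := fun hbd => h (by rw [hac, hbd])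
      simp [this]
    · left
      simp [hac]
  · intro f g hf hg
    obtain ⟨a, ha⟩ := Function.ne_iff.mp hf
    obtain ⟨b, hb⟩ := Function.ne_iff.mp hg
    refine ⟨(a, b), ?_, ?_⟩
    · simpa [Pi.star_single] using ha
    · simpa [Pi.star_single] using hb

end UnextendibleMissing

namespace BipartiteMissing

variable {m m' n n' s s' : ℕ}

theorem zero (m n : ℕ) : BipartiteMissing m n 0 := UnextendibleMissing.zero _ _

theorem swap (h : BipartiteMissing m n s) : BipartiteMissing n m s := UnextendibleMissing.swap h

theorem add_left (h : BipartiteMissing m n s) (h' : BipartiteMissing m' n s') :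
    BipartiteMissing (m + m') n (s + s') :=
  (UnextendibleMissing.sum_left h h').congr_left finSumFinEquiv

theorem mono_left (h : BipartiteMissing m n s) (hm : m ≤ m') : BipartiteMissing m' n s := by
  obtain ⟨r, rfl⟩ := Nat.exists_eq_add_of_le hm
  exact h.add_left (zero r n)

theorem mono (h : BipartiteMissing m n s) (hm : m ≤ m') (hn : n ≤ n') : BipartiteMissing m' n' s :=
  ((h.mono_left hm).swap.mono_left hn).swap

end BipartiteMissing

/-! ### From bipartite families to multipartite bases -/

theorem hasUPBWithMissingNumber_of_family {N : ℕ} {d : Fin N → ℕ} {s : ℕ} (hs : 0 < s)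
    {ι : Type} [Fintype ι] (v : ι → (i : Fin N) → Fin (d i) → ℂ)
    (hv : ∀ j i, v j i ≠ 0) (ho : ∀ j l, j ≠ l → ∃ i, star (v j i) ⬝ᵥ v l i = 0)
    (hu : ∀ f : (i : Fin N) → Fin (d i) → ℂ, (∀ i, f i ≠ 0) →
      ∃ j, ∀ i, star (v j i) ⬝ᵥ f i ≠ 0)
    (hc : Fintype.card ι + s = ∏ i, d i) : HasUPBWithMissingNumber d s := by
  classical
  let e := (Fintype.equivFin ι).symm
  let u : ι → (i : Fin N) → EuclideanSpace ℂ (Fin (d i)) := fun j i => WithLp.toLp 2 (v j i)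
  have hu0 : ∀ j i, u j i ≠ 0 := fun j i h => hv j i (by simpa [u] using h)
  let U : ι → (i : Fin N) → EuclideanSpace ℂ (Fin (d i)) :=
    fun j i => ((‖u j i‖⁻¹ : ℝ) : ℂ) • u j i
  have hU1 : ∀ j i, ‖U j i‖ = 1 := fun j i => by
    have := norm_ne_zero_iff.mpr (hu0 j i)
    simp only [U, norm_smul, Complex.norm_real, norm_inv, norm_norm]
    field_simp
  have hUin : ∀ j i (f : EuclideanSpace ℂ (Fin (d i))),
      inner ℂ (U j i) f = ((‖u j i‖⁻¹ : ℝ) : ℂ) * (star (v j i) ⬝ᵥ f.ofLp) := fun j i f => by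
    simp only [U, inner_smul_left, Complex.conj_ofReal]
    rw [EuclideanSpace.inner_eq_star_dotProduct, dotProduct_comm]
  refine ⟨Fintype.card ι, fun j => tensorVector (U (e j)), ⟨by omega, ?_, ?_, ?_⟩, hc⟩
  · exact fun j => ⟨U (e j), hU1 _, rfl⟩
  · rw [orthonormal_iff_ite]
    intro j l
    rw [inner_tensorVector]
    split_ifs with h
    · subst h
      refine Finset.prod_eq_one fun i _ => ?_
      rw [inner_self_eq_norm_sq_to_K, hU1]
      simp
    · obtain ⟨i, hi⟩ := ho (e j) (e l) (fun h' => h (e.injective h'))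
      refine Finset.prod_eq_zero (Finset.mem_univ i) ?_
      rw [hUin]
      simp [U, u, hi]
  · rintro ψ hψ ⟨w, hw, rfl⟩
    obtain ⟨j, hj⟩ := hu (fun i => (w i).ofLp) (fun i h => by
      have h0 : w i = 0 := by ext x; exact congrFun h x
      have := hw i
      simp [h0] at this)
    have h1 := hψ (e.symm j)
    rw [inner_tensorVector, Finset.prod_eq_zero_iff] at h1
    obtain ⟨i, -, hi⟩ := h1
    rw [Equiv.apply_symm_apply, hUin, mul_eq_zero] at hi
    rcases hi with hi | hi
    · have := norm_ne_zero_iff.mpr (hu0 j i)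
      simp at hi
      exact hu0 j i hi
    · exact hj i hi

/-- Distinct labels `x` differ in some remaining factor, which gives orthogonality between blocks.
For unextendibility, choose a nonzero coordinate of the test vector in each remaining factor; these
coordinates select the block to use. -/
theorem hasUPBWithMissingNumber_sum {M : ℕ} {d : Fin (M + 2) → ℕ}
    (s : ((i : Fin M) → Fin (d i.succ.succ)) → ℕ)
    (hB : ∀ x, BipartiteMissing (d 0) (d 1) (s x)) (hs : 0 < ∑ x, s x) :
    HasUPBWithMissingNumber d (∑ x, s x) := by
  classical
  choose ι hι v w hv hw ho hu hc using hB
  refine hasUPBWithMissingNumber_of_family (ι := Σ x, ι x) hs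
    (fun j => Fin.cons (v j.1 j.2) (Fin.cons (w j.1 j.2) (fun i => Pi.single (j.1 i) 1)))
    ?_ ?_ ?_ ?_
  · rintro ⟨x, j⟩ i
    refine Fin.cases ?_ (fun i => Fin.cases ?_ (fun i => ?_) i) i
    · exact hv x j
    · exact hw x j
    · change (Pi.single (x i) (1 : ℂ) : Fin (d i.succ.succ) → ℂ) ≠ 0
      simp
  · rintro ⟨x, j⟩ ⟨y, l⟩ hjl
    by_cases hxy : x = y
    · subst hxy
      rcases ho x j l (fun h => hjl (by rw [h])) with h | h
      · exact ⟨0, h⟩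
      · exact ⟨1, h⟩
    · obtain ⟨i, hi⟩ := Function.ne_iff.mp hxy
      refine ⟨i.succ.succ, ?_⟩
      change star (Pi.single (x i) (1 : ℂ) : Fin (d i.succ.succ) → ℂ) ⬝ᵥ
        (Pi.single (y i) (1 : ℂ) : Fin (d i.succ.succ) → ℂ) = 0
      simp [hi]
  · intro f hf
    have h : ∀ i : Fin M, ∃ a, f i.succ.succ a ≠ 0 := fun i => Function.ne_iff.mp (hf i.succ.succ)
    choose x hx using h
    obtain ⟨j, h0, h1⟩ := hu x (f 0) (f 1) (hf 0) (hf 1)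
    refine ⟨⟨x, j⟩, fun i => ?_⟩
    refine Fin.cases ?_ (fun i => Fin.cases ?_ (fun i => ?_) i) i
    · exact h0
    · exact h1
    · change star (Pi.single (x i) (1 : ℂ) : Fin (d i.succ.succ) → ℂ) ⬝ᵥ f i.succ.succ ≠ 0
      simpa [Pi.star_single] using hx i
  · rw [Fintype.card_sigma, ← Finset.sum_add_distrib, Finset.sum_congr rfl fun x _ => hc x]
    simp only [Fintype.card_fin, Finset.sum_const, Finset.card_univ, Fintype.card_pi, smul_eq_mul,
      Fin.prod_univ_succ (n := M + 1), Fin.prod_univ_succ (n := M)]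
    rw [mul_comm, mul_assoc]
    rfl

/-! ### Weighted Fourier vectors and minimal families -/

/-- The vectors `(√(a x) α ^ (j x))` for `x < p`. -/
noncomputable def fourierVector (p : ℕ) (a : ℕ → ℝ) (α : ℂ) (j : ℕ) : Fin p → ℂ :=
  fun x => (Real.sqrt (a x) : ℂ) * (α ^ j) ^ (x : ℕ)

theorem star_fourierVector_dotProduct {p : ℕ} {a : ℕ → ℝ} {α : ℂ} (ha : ∀ x < p, 0 < a x)
    (hα : ‖α‖ = 1) (j δ : ℕ) :
    star (fourierVector p a α j) ⬝ᵥ fourierVector p a α (j + δ) =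
      ∑ x ∈ Finset.range p, (a x : ℂ) * (α ^ δ) ^ x := by
  rw [Finset.sum_range, dotProduct]
  refine Finset.sum_congr rfl fun x _ => ?_
  have hc : (starRingEnd ℂ) α * α = 1 := by
    rw [mul_comm, Complex.mul_conj, Complex.normSq_eq_norm_sq, hα]; simp
  have hs : (Real.sqrt (a x) : ℂ) * Real.sqrt (a x) = a x := by
    rw [← Complex.ofReal_mul, Real.mul_self_sqrt (ha x x.2).le]
  simp only [fourierVector, Pi.star_apply, star_mul', RCLike.star_def, Complex.conj_ofReal, map_pow]
  calc _ = ((Real.sqrt (a x) : ℂ) * Real.sqrt (a x)) *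
        (((starRingEnd ℂ) α * α) ^ j) ^ (x : ℕ) * (α ^ δ) ^ (x : ℕ) := by
        rw [pow_add]; simp only [mul_pow]; ring
    _ = _ := by rw [hc, hs]; simp

theorem fourierVector_ne_zero {p : ℕ} {a : ℕ → ℝ} {α : ℂ} (hp : 0 < p) (ha : ∀ x < p, 0 < a x)
    (j : ℕ) : fourierVector p a α j ≠ 0 := by
  intro h
  have := congrFun h ⟨0, hp⟩
  simp [fourierVector, (Real.sqrt_pos.mpr (ha 0 hp)).ne'] at this

/-- The inner product with `f` is a nonzero polynomial of degree at most `p - 1`, evaluated at the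
conjugate of `α ^ j`; these points are distinct for `j < k`. -/
theorem card_orthogonal_fourierVector {p k : ℕ} {a : ℕ → ℝ} {α : ℂ} (ha : ∀ x < p, 0 < a x)
    (hα : ‖α‖ = 1) (hα1 : ∀ δ, 0 < δ → δ < k → α ^ δ ≠ 1) {f : Fin p → ℂ} (hf : f ≠ 0) :
    ((Finset.range k).filter fun j => star (fourierVector p a α j) ⬝ᵥ f = 0).card ≤ p - 1 := by
  classical
  have hα0 : α ≠ 0 := by
    intro h; simp [h] at hα
  set P : Polynomial ℂ := ∑ x : Fin p,
    Polynomial.C ((Real.sqrt (a x) : ℂ) * f x) * Polynomial.X ^ (x : ℕ) with hP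
  have hcoeff : ∀ x : Fin p, P.coeff x = (Real.sqrt (a x) : ℂ) * f x := by
    intro x
    rw [hP, Polynomial.finsetSum_coeff, Finset.sum_eq_single x]
    · rw [Polynomial.coeff_C_mul, Polynomial.coeff_X_pow_self, mul_one]
    · intro y _ hy
      rw [Polynomial.coeff_C_mul, Polynomial.coeff_X_pow, if_neg (fun h => hy (Fin.ext h.symm)),
        mul_zero]
    · simp
  obtain ⟨x, hx⟩ := Function.ne_iff.mp hf
  have hP0 : P ≠ 0 := by
    intro h
    have h1 := hcoeff x
    rw [h, Polynomial.coeff_zero] at h1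
    have h2 := (Real.sqrt_pos.mpr (ha x x.2)).ne'
    simp [h2] at h1
    exact hx h1
  have hdeg : P.natDegree ≤ p - 1 := by
    refine Polynomial.natDegree_sum_le_of_forall_le _ _ fun y _ => ?_
    exact (Polynomial.natDegree_C_mul_X_pow_le _ _).trans (by have := y.2; omega)
  set r : ℕ → ℂ := fun j => (starRingEnd ℂ) (α ^ j) with hr
  have hinj : Set.InjOn r (Finset.range k : Set ℕ) := by
    have aux : ∀ i j, i < j → j < k → r i ≠ r j := by
      intro i j hij hj h
      have h1 : α ^ i = α ^ j := (starRingEnd ℂ).injective h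
      obtain ⟨δ, rfl⟩ := Nat.exists_eq_add_of_lt hij
      rw [add_assoc, pow_add] at h1
      exact hα1 (δ + 1) (by omega) (by omega)
        (mul_left_cancel₀ (pow_ne_zero i hα0) (by rw [← h1, mul_one]))
    intro i hi j hj h
    simp only [Finset.coe_range, Set.mem_Iio] at hi hj
    rcases lt_trichotomy i j with hij | hij | hij
    · exact absurd h (aux i j hij hj)
    · exact hij
    · exact absurd h.symm (aux j i hij hi)
  calc _ = (((Finset.range k).filter fun j =>
        star (fourierVector p a α j) ⬝ᵥ f = 0).image r).card :=
        (Finset.card_image_of_injOn (hinj.mono (by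
          intro x hx
          simp only [Finset.coe_filter, Set.mem_ofPred_eq] at hx
          exact_mod_cast hx.1))).symm
    _ ≤ P.natDegree := by
        refine Polynomial.card_le_degree_of_subset_roots ?_
        intro z hz
        simp only [Finset.image_val, Multiset.mem_dedup, Multiset.mem_map, Finset.mem_val,
          Finset.mem_filter] at hz
        obtain ⟨j, ⟨-, hj⟩, rfl⟩ := hz
        rw [Polynomial.mem_roots hP0, Polynomial.IsRoot, hP, Polynomial.eval_finsetSum, ← hj,
          dotProduct]
        refine Finset.sum_congr rfl fun y _ => ?_
        simp only [fourierVector, Pi.star_apply, star_mul', RCLike.star_def, Complex.conj_ofReal,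
          map_pow, Polynomial.eval_mul, Polynomial.eval_C, Polynomial.eval_pow, Polynomial.eval_X,
          hr]
        ring
    _ ≤ p - 1 := hdeg

/-- Two families of Fourier vectors whose orthogonality relations cover all pairs. -/
theorem bipartiteMissing_of_weights {p n : ℕ} (hp : 0 < p) (hn : 0 < n) {a b : ℕ → ℝ}
    (ha : ∀ x < p, 0 < a x) (hb : ∀ y < n, 0 < b y) {α β : ℂ}
    (hα : ‖α‖ = 1) (hβ : ‖β‖ = 1) (hα1 : ∀ δ, 0 < δ → δ < p + n - 1 → α ^ δ ≠ 1)
    (hβ1 : ∀ δ, 0 < δ → δ < p + n - 1 → β ^ δ ≠ 1)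
    (h0 : ∀ δ, 0 < δ → δ < p + n - 1 →
      ∑ x ∈ Finset.range p, (a x : ℂ) * (α ^ δ) ^ x = 0 ∨
      ∑ y ∈ Finset.range n, (b y : ℂ) * (β ^ δ) ^ y = 0) :
    BipartiteMissing p n ((p - 1) * (n - 1)) := by
  classical
  have conj0 : ∀ {m : ℕ} {f g : Fin m → ℂ}, star f ⬝ᵥ g = 0 → star g ⬝ᵥ f = 0 := by
    intro m f g h
    rw [← star_star f, Matrix.star_dotProduct_star, h, star_zero]
  have hlt : ∀ i j, i < j → j < p + n - 1 →
      star (fourierVector p a α i) ⬝ᵥ fourierVector p a α j = 0 ∨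
      star (fourierVector n b β i) ⬝ᵥ fourierVector n b β j = 0 := by
    intro i j hij hj
    obtain ⟨δ, rfl⟩ := Nat.exists_eq_add_of_lt hij
    rw [add_assoc, star_fourierVector_dotProduct ha hα, star_fourierVector_dotProduct hb hβ]
    exact h0 _ (by omega) (by omega)
  refine ⟨Fin (p + n - 1), inferInstance, fun j => fourierVector p a α j,
    fun j => fourierVector n b β j, fun j => fourierVector_ne_zero hp ha _,
    fun j => fourierVector_ne_zero hn hb _, ?_, ?_, ?_⟩
  · intro j l hjl
    rcases lt_or_gt_of_ne hjl with h | h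
    · exact hlt j l h l.2
    · exact (hlt l j h j.2).imp conj0 conj0
  · intro f g hf hg
    by_contra! hcon
    have h1 := card_orthogonal_fourierVector ha hα hα1 hf
    have h2 := card_orthogonal_fourierVector hb hβ hβ1 hg
    have h3 : Finset.range (p + n - 1) ⊆
        ((Finset.range (p + n - 1)).filter fun j => star (fourierVector p a α j) ⬝ᵥ f = 0) ∪
        ((Finset.range (p + n - 1)).filter fun j => star (fourierVector n b β j) ⬝ᵥ g = 0) := by
      intro j hj
      have h := hcon ⟨j, Finset.mem_range.mp hj⟩
      simp only [Finset.mem_union, Finset.mem_filter]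
      by_cases hc : star (fourierVector p a α j) ⬝ᵥ f = 0
      · exact Or.inl ⟨hj, hc⟩
      · exact Or.inr ⟨hj, h hc⟩
    have h4 := (Finset.card_le_card h3).trans (Finset.card_union_le _ _)
    rw [Finset.card_range] at h4
    omega
  · simp only [Fintype.card_fin]
    obtain ⟨p, rfl⟩ := Nat.exists_eq_succ_of_ne_zero hp.ne'
    obtain ⟨n, rfl⟩ := Nat.exists_eq_succ_of_ne_zero hn.ne'
    simp only [Nat.succ_eq_add_one, Nat.add_sub_cancel]
    have : p + 1 + (n + 1) - 1 = p + n + 1 := by omega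
    rw [this]
    ring

/-! ### Trigonometric Gaussian binomials: zeros and signs -/

/-- The symmetric Gaussian binomial coefficient `[N choose i]` at `q = exp (2 i φ)`. -/
noncomputable def sinBinom (N : ℕ) (φ : ℝ) (i : ℕ) : ℝ :=
  ∏ j ∈ Finset.range i, Real.sin (((N : ℝ) - j) * φ) / Real.sin (((j : ℝ) + 1) * φ)

theorem sinBinom_zero (N : ℕ) (φ : ℝ) : sinBinom N φ 0 = 1 := by simp [sinBinom]

theorem sinBinom_succ (N : ℕ) (φ : ℝ) (i : ℕ) : sinBinom N φ (i + 1) =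
    sinBinom N φ i * (Real.sin (((N : ℝ) - i) * φ) / Real.sin (((i : ℝ) + 1) * φ)) := by
  rw [sinBinom, Finset.prod_range_succ, ← sinBinom]

theorem sinBinom_pos {N : ℕ} {φ : ℝ} (hφ : 0 < φ) (h : N * φ < Real.pi) {i : ℕ} (hi : i ≤ N) :
    0 < sinBinom N φ i := by
  refine Finset.prod_pos fun j hj => ?_
  have hj : ((j : ℝ) + 1) ≤ N := by
    have := Finset.mem_range.mp hj
    exact_mod_cast (by omega : j + 1 ≤ N)
  have hj0 : (0 : ℝ) ≤ j := j.cast_nonneg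
  refine div_pos (Real.sin_pos_of_pos_of_lt_pi ?_ ?_) (Real.sin_pos_of_pos_of_lt_pi ?_ ?_)
  · exact mul_pos (by linarith) hφ
  · nlinarith
  · positivity
  · nlinarith

/-- The recursion of the coefficients is a functional equation of the generating polynomial. -/
theorem sum_eq_zero_of_recursion {N : ℕ} {φ : ℝ} {b : ℕ → ℝ}
    (hb : ∀ i < N, Real.sin (((i : ℝ) + 1) * φ) * b (i + 1) = Real.sin (((N : ℝ) - i) * φ) * b i)
    {ζ : ℂ} (hζ : ζ = Complex.exp (φ * Complex.I)) {c : ℕ}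
    (hne : ∀ m ≤ c, ζ ^ (2 * N) ≠ ζ ^ (2 * m)) :
    ∑ i ∈ Finset.range (N + 1), (b i : ℂ) * (-(ζ ^ (2 * c) * ζ * ζ⁻¹ ^ N)) ^ i = 0 := by
  have hζ0 : ζ ≠ 0 := by rw [hζ]; exact Complex.exp_ne_zero _
  have hsin : ∀ x : ℤ, ζ ^ x - ζ ^ (-x) = 2 * Complex.I * (Real.sin (x * φ) : ℂ) := by
    intro x
    rw [hζ, ← Complex.exp_int_mul, ← Complex.exp_int_mul, Complex.ofReal_sin, Complex.sin]
    have h1 : ((x : ℂ)) * (φ * Complex.I) = ((x * φ : ℝ) : ℂ) * Complex.I := by push_cast; ring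
    have h2 : ((-x : ℤ) : ℂ) * (φ * Complex.I) = -((x * φ : ℝ) : ℂ) * Complex.I := by
      push_cast; ring
    rw [h1, h2]
    ring_nf
    rw [Complex.I_sq]
    ring
  set f : ℂ → ℂ := fun z => ∑ i ∈ Finset.range (N + 1), (b i : ℂ) * z ^ i with hf
  -- Comparing coefficients of `z ^ (i + 1)` gives exactly the recursion. The equation carries a
  -- zero at `ζ⁻¹ * z` to one at `ζ * z`, unless the factor on the left vanishes, which `hne`
  -- excludes.
  have key : ∀ z : ℂ, f (ζ * z) * (1 + ζ⁻¹ ^ N * z) = f (ζ⁻¹ * z) * (1 + ζ ^ N * z) := by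
    intro z
    have h1 : f (ζ * z) - f (ζ⁻¹ * z) = ∑ i ∈ Finset.range N,
        (b (i + 1) : ℂ) * (ζ ^ ((i : ℤ) + 1) - ζ ^ (-((i : ℤ) + 1))) * z ^ (i + 1) := by
      simp only [hf, ← Finset.sum_sub_distrib]
      rw [Finset.sum_range_succ']
      simp only [pow_zero, sub_self, add_zero]
      refine Finset.sum_congr rfl fun i _ => ?_
      rw [zpow_neg, ← Nat.cast_succ, zpow_natCast, mul_pow, mul_pow, inv_pow,
        Nat.succ_eq_add_one]
      ring
    have h2 : z * (ζ ^ N * f (ζ⁻¹ * z) - ζ⁻¹ ^ N * f (ζ * z)) = ∑ i ∈ Finset.range N,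
        (b i : ℂ) * (ζ ^ ((N : ℤ) - i) - ζ ^ (-((N : ℤ) - i))) * z ^ (i + 1) := by
      simp only [hf, Finset.mul_sum, ← Finset.sum_sub_distrib]
      rw [Finset.sum_range_succ]
      have : z * (ζ ^ N * (↑(b N) * (ζ⁻¹ * z) ^ N) - ζ⁻¹ ^ N * (↑(b N) * (ζ * z) ^ N)) = 0 := by
        rw [mul_pow, mul_pow, inv_pow]
        field_simp
        ring
      rw [this, add_zero]
      refine Finset.sum_congr rfl fun i _ => ?_
      rw [zpow_neg, zpow_sub₀ hζ0, zpow_natCast, zpow_natCast, mul_pow, mul_pow, inv_pow, inv_pow,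
        inv_div]
      field_simp
      ring
    have h3 : f (ζ * z) - f (ζ⁻¹ * z) = z * (ζ ^ N * f (ζ⁻¹ * z) - ζ⁻¹ ^ N * f (ζ * z)) := by
      rw [h1, h2]
      refine Finset.sum_congr rfl fun i hi => ?_
      rw [hsin, hsin]
      have := hb i (Finset.mem_range.mp hi)
      have h4 : (Real.sin (((i : ℝ) + 1) * φ) : ℂ) * b (i + 1) =
        Real.sin (((N : ℝ) - i) * φ) * b i := by exact_mod_cast this
      push_cast at h4 ⊢
      linear_combination 2 * Complex.I * z ^ (i + 1) * h4
    linear_combination h3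
  have hζN : ζ⁻¹ ^ N * ζ ^ N = 1 := by rw [← mul_pow, inv_mul_cancel₀ hζ0, one_pow]
  have main : ∀ c : ℕ, (∀ m ≤ c, ζ ^ (2 * N) ≠ ζ ^ (2 * m)) →
      f (-(ζ ^ (2 * c) * ζ * ζ⁻¹ ^ N)) = 0 := by
    intro c
    induction c with
    | zero =>
      intro hne
      -- This `z` kills the factor on the right and so starts the chain of zeros.
      have h := key (-(ζ⁻¹ ^ N))
      have h1 : 1 + ζ ^ N * -(ζ⁻¹ ^ N) = 0 := by linear_combination -hζN
      rw [h1, mul_zero, mul_eq_zero] at h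
      rcases h with h | h
      · rw [← h]; congr 1; ring
      · exfalso
        apply hne 0 le_rfl
        rw [mul_zero, pow_zero, two_mul, pow_add]
        linear_combination (ζ ^ N * ζ ^ N) * h + (ζ⁻¹ ^ N * ζ ^ N + 1) * hζN
    | succ c ih =>
      intro hne
      have ih := ih fun m hm => hne m (by omega)
      have h := key (-(ζ ^ (2 * (c + 1)) * ζ⁻¹ ^ N))
      have h1 : ζ⁻¹ * -(ζ ^ (2 * (c + 1)) * ζ⁻¹ ^ N) = -(ζ ^ (2 * c) * ζ * ζ⁻¹ ^ N) := by
        rw [mul_add, pow_add]; field_simp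
      rw [h1, ih, zero_mul, mul_eq_zero] at h
      rcases h with h | h
      · rw [← h]; congr 1; ring
      · exfalso
        apply hne (c + 1) le_rfl
        rw [two_mul N, pow_add]
        linear_combination (ζ ^ N * ζ ^ N) * h +
          (ζ ^ (2 * (c + 1)) * (ζ⁻¹ ^ N * ζ ^ N + 1)) * hζN
  exact main c hne

theorem exp_pow_two_mul_ne_one {φ : ℝ} {i : ℕ} (h : Real.sin (i * φ) ≠ 0) :
    Complex.exp (φ * Complex.I) ^ (2 * i) ≠ 1 := by
  intro h1
  rw [← Complex.exp_nat_mul, Complex.exp_eq_one_iff] at h1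
  obtain ⟨n, hn⟩ := h1
  apply h
  have h2 : (i * φ : ℝ) = n * Real.pi := by
    have h3 : (2 * Complex.I) * ((i * φ : ℝ) : ℂ) = (2 * Complex.I) * ((n * Real.pi : ℝ) : ℂ) := by
      push_cast at hn ⊢
      linear_combination hn
    have := mul_left_cancel₀ (by simp) h3
    exact_mod_cast this
  rw [h2, Real.sin_int_mul_pi]

theorem sinBinom_recursion {N : ℕ} {φ : ℝ} (hφ : ∀ i, 0 < i → i ≤ N → Real.sin (i * φ) ≠ 0)
    {i : ℕ} (hi : i < N) : Real.sin (((i : ℝ) + 1) * φ) * sinBinom N φ (i + 1) =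
      Real.sin (((N : ℝ) - i) * φ) * sinBinom N φ i := by
  have := hφ (i + 1) (by omega) (by omega)
  push_cast at this
  rw [sinBinom_succ]
  field_simp

theorem sum_sinBinom_eq_zero {N : ℕ} {φ : ℝ}
    (hφ : ∀ i, 0 < i → i ≤ N → Real.sin (i * φ) ≠ 0)
    {ζ : ℂ} (hζ : ζ = Complex.exp (φ * Complex.I)) {c : ℕ} (hc : c < N) :
    ∑ i ∈ Finset.range (N + 1), (sinBinom N φ i : ℂ) * (-(ζ ^ (2 * c) * ζ * ζ⁻¹ ^ N)) ^ i = 0 := by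
  have hζ0 : ζ ≠ 0 := by rw [hζ]; exact Complex.exp_ne_zero _
  refine sum_eq_zero_of_recursion (φ := φ) (fun i hi => sinBinom_recursion hφ hi) hζ
    (fun m hm h => ?_)
  obtain ⟨r, rfl⟩ := Nat.exists_eq_add_of_lt (lt_of_le_of_lt hm hc)
  rw [show 2 * (m + r + 1) = 2 * m + 2 * (r + 1) by ring, pow_add] at h
  have h1 : ζ ^ (2 * (r + 1)) = 1 := mul_left_cancel₀ (pow_ne_zero _ hζ0) (by rw [h, mul_one])
  rw [hζ] at h1
  exact exp_pow_two_mul_ne_one (hφ (r + 1) (by omega) (by omega)) h1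

theorem sinBinom_symm {N : ℕ} {φ : ℝ} (hφ : ∀ i, 0 < i → i ≤ N → Real.sin (i * φ) ≠ 0)
    {i : ℕ} (hi : i ≤ N) : sinBinom N φ (N - i) = sinBinom N φ i := by
  induction i with
  | zero =>
    rw [sinBinom_zero, Nat.sub_zero, sinBinom, Finset.prod_div_distrib,
      ← Finset.prod_range_reflect, div_eq_one_iff_eq]
    · refine Finset.prod_congr rfl fun j hj => ?_
      have := Finset.mem_range.mp hj
      rw [Nat.cast_sub (by omega), Nat.cast_sub (by omega)]
      congr 1
      push_cast
      ring
    · refine Finset.prod_ne_zero_iff.mpr fun j hj => ?_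
      have := hφ (j + 1) (by omega) (by have := Finset.mem_range.mp hj; omega)
      exact_mod_cast this
  | succ i ih =>
    have ih := ih (by omega)
    have h1 := sinBinom_recursion hφ (i := N - (i + 1)) (by omega)
    have h2 := sinBinom_recursion hφ (i := i) (by omega)
    rw [show N - (i + 1) + 1 = N - i by omega, ih, Nat.cast_sub hi] at h1
    have h3 := hφ (i + 1) (by omega) hi
    push_cast at h1 h3
    apply mul_left_cancel₀ h3
    rw [h2, show (N : ℝ) - i = N - (i + 1) + 1 by ring, h1]
    congr 2
    ring

/-- The coefficients of `∏ (1 - q ^ δ z)`, `0 < |δ| ≤ t`, at `q = exp (2 i φ)`. -/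
noncomputable def sinAlt (t : ℕ) (φ : ℝ) (i : ℕ) : ℝ :=
  ∑ l ∈ Finset.range (i + 1), (-1) ^ l * sinBinom (2 * t + 1) φ l

theorem sinAlt_zero (t : ℕ) (φ : ℝ) : sinAlt t φ 0 = 1 := by simp [sinAlt, sinBinom_zero]

theorem sinAlt_succ (t : ℕ) (φ : ℝ) (i : ℕ) :
    sinAlt t φ (i + 1) = sinAlt t φ i + (-1) ^ (i + 1) * sinBinom (2 * t + 1) φ (i + 1) := by
  rw [sinAlt, Finset.sum_range_succ, ← sinAlt]

theorem sinAlt_last {t : ℕ} {φ : ℝ} (hφ : ∀ i, 0 < i → i ≤ 2 * t + 1 → Real.sin (i * φ) ≠ 0) :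
    sinAlt t φ (2 * t + 1) = 0 := by
  have h := sum_sinBinom_eq_zero hφ rfl (c := t) (by omega)
  set ζ := Complex.exp (φ * Complex.I)
  have hζ0 : ζ ≠ 0 := Complex.exp_ne_zero _
  have h1 : ζ ^ (2 * t) * ζ * ζ⁻¹ ^ (2 * t + 1) = 1 := by
    rw [← pow_succ, ← mul_pow, mul_inv_cancel₀ hζ0, one_pow]
  rw [h1] at h
  have h2 : ((sinAlt t φ (2 * t + 1) : ℝ) : ℂ) = 0 := by
    rw [← h, sinAlt]
    push_cast
    exact Finset.sum_congr rfl fun _ _ => mul_comm _ _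
  exact_mod_cast h2

/-- Taking partial sums of coefficients divides the alternating binomial polynomial by `1 - z`. The
division is exact by `sinAlt_last`, and it removes only the central zero `z = 1` of the `2 * t + 1`
zeros. -/
theorem sum_sinAlt_eq_zero {t : ℕ} {φ : ℝ}
    (hφ : ∀ i, 0 < i → i ≤ 2 * t + 1 → Real.sin (i * φ) ≠ 0)
    {ζ : ℂ} (hζ : ζ = Complex.exp (φ * Complex.I)) {c : ℕ} (hc : c ≤ 2 * t)
    {z : ℂ} (hz : z * ζ ^ (2 * t) = ζ ^ (2 * c)) (hz1 : z ≠ 1) :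
    ∑ i ∈ Finset.range (2 * t + 1), (sinAlt t φ i : ℂ) * z ^ i = 0 := by
  have hζ0 : ζ ≠ 0 := by rw [hζ]; exact Complex.exp_ne_zero _
  have h := sum_sinBinom_eq_zero hφ hζ (c := c) (by omega)
  have h1 : ζ ^ (2 * c) * ζ * ζ⁻¹ ^ (2 * t + 1) = z := by
    rw [← hz, mul_assoc z, ← pow_succ, mul_assoc, ← mul_pow, mul_inv_cancel₀ hζ0, one_pow, mul_one]
  rw [h1] at h
  have aux : ∀ m : ℕ, (1 - z) * ∑ i ∈ Finset.range m, (sinAlt t φ i : ℂ) * z ^ i =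
      ∑ i ∈ Finset.range m, (sinBinom (2 * t + 1) φ i : ℂ) * (-z) ^ i -
        (if m = 0 then 0 else (sinAlt t φ (m - 1) : ℂ) * z ^ m) := by
    intro m
    induction m with
    | zero => simp
    | succ m ih =>
      rw [Finset.sum_range_succ, mul_add, ih, Finset.sum_range_succ]
      rcases m with _ | m
      · simp [sinAlt_zero, sinBinom_zero]
      · simp only [Nat.succ_ne_zero, if_false, Nat.add_sub_cancel, sinAlt_succ]
        push_cast
        rw [neg_pow z]
        ring
  have h2 := aux (2 * t + 2)
  rw [h, Finset.sum_range_succ, if_neg (by omega), show 2 * t + 2 - 1 = 2 * t + 1 by omega,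
    sinAlt_last hφ] at h2
  simp only [Complex.ofReal_zero, zero_mul, add_zero, sub_self, mul_eq_zero] at h2
  rcases h2 with h2 | h2
  · exact absurd (sub_eq_zero.mp h2).symm hz1
  · exact h2

theorem sinAlt_symm {t : ℕ} {φ : ℝ} (hφ : ∀ i, 0 < i → i ≤ 2 * t + 1 → Real.sin (i * φ) ≠ 0)
    {i : ℕ} (hi : i ≤ 2 * t) : sinAlt t φ (2 * t - i) = sinAlt t φ i := by
  induction i with
  | zero =>
    have h := sinAlt_last hφ
    have h1 := sinBinom_symm hφ (i := 0) (by omega)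
    rw [Nat.sub_zero, sinBinom_zero] at h1
    rw [sinAlt_succ, h1, pow_succ, pow_mul] at h
    rw [Nat.sub_zero, sinAlt_zero]
    norm_num at h
    linarith
  | succ i ih =>
    have ih := ih (by omega)
    have h1 := sinAlt_succ t φ (2 * t - (i + 1))
    have h2 := sinBinom_symm hφ (i := i + 1) (by omega)
    rw [show 2 * t + 1 - (i + 1) = 2 * t - i by omega] at h2
    rw [show 2 * t - (i + 1) + 1 = 2 * t - i by omega, ih, h2] at h1
    have h3 : (-1 : ℝ) ^ (2 * t - i) = (-1) ^ i :=
      neg_one_pow_congr (by rw [Nat.even_sub (by omega)]; simp)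
    rw [h3] at h1
    rw [sinAlt_succ, pow_succ]
    linarith

theorem sin_sub_sin_reflect (t i : ℕ) (φ : ℝ) :
    Real.sin (((2 * t + 1 : ℕ) - (i : ℝ)) * φ) - Real.sin (((i : ℝ) + 1) * φ) =
      2 * Real.sin (((t : ℝ) - i) * φ) * Real.cos (((t : ℝ) + 1) * φ) := by
  rw [Real.sin_sub_sin]
  push_cast
  congr 3 <;> ring

/-- Consecutive summands have ratio `-σ / τ` with `σ < τ`, because `cos ((t + 1) φ) < 0`. While `σ <
0` the summands stay nonnegative; afterwards each step subtracts less than the current partial sum.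
Symmetry covers the upper half. -/
theorem sinAlt_pos {t : ℕ} {φ : ℝ} (hφ : ∀ i, 0 < i → i ≤ 2 * t + 1 → Real.sin (i * φ) ≠ 0)
    (hφ0 : 0 < φ) (h1 : Real.pi / 2 < (t + 1) * φ) (h2 : (t + 1) * φ < Real.pi) {i : ℕ}
    (hi : i ≤ 2 * t) : 0 < sinAlt t φ i := by
  have main : ∀ i ≤ t, 0 < sinAlt t φ i ∧
      (-1) ^ i * sinBinom (2 * t + 1) φ i ≤ sinAlt t φ i ∧
      (Real.sin (((2 * t + 1 : ℕ) - (i : ℝ)) * φ) < 0 →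
        0 ≤ (-1) ^ i * sinBinom (2 * t + 1) φ i) := by
    intro i
    induction i with
    | zero => simp [sinAlt_zero, sinBinom_zero]
    | succ i ih =>
      intro hi
      obtain ⟨e0, e1, e2⟩ := ih (by omega)
      have hit : (i : ℝ) + 1 ≤ t := by exact_mod_cast hi
      have hi0 : (0 : ℝ) ≤ i := i.cast_nonneg
      have hτ : 0 < Real.sin (((i : ℝ) + 1) * φ) :=
        Real.sin_pos_of_pos_of_lt_pi (by positivity) (by nlinarith)
      have hlt : Real.sin (((2 * t + 1 : ℕ) - (i : ℝ)) * φ) < Real.sin (((i : ℝ) + 1) * φ) := by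
        have h := sin_sub_sin_reflect t i φ
        have h3 : 0 < Real.sin (((t : ℝ) - i) * φ) :=
          Real.sin_pos_of_pos_of_lt_pi (mul_pos (by linarith) hφ0) (by nlinarith)
        have h4 : Real.cos (((t : ℝ) + 1) * φ) < 0 :=
          Real.cos_neg_of_pi_div_two_lt_of_lt h1 (by linarith [Real.pi_pos])
        nlinarith [mul_pos_of_neg_of_neg (neg_lt_zero.mpr h3) h4]
      rw [sinAlt_succ, sinBinom_succ]
      set D := (-1) ^ i * sinBinom (2 * t + 1) φ i with hD
      set σ := Real.sin (((2 * t + 1 : ℕ) - (i : ℝ)) * φ) with hσ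
      set τ := Real.sin (((i : ℝ) + 1) * φ)
      have hS : σ / τ < 1 := (div_lt_one hτ).mpr hlt
      have hDD : (-1) ^ (i + 1) * (sinBinom (2 * t + 1) φ i * (σ / τ)) = -(σ / τ) * D := by
        rw [hD]; ring
      rw [hDD]
      rcases lt_or_ge σ 0 with hneg | hpos
      · have hD0 := e2 hneg
        have : 0 ≤ -(σ / τ) * D := mul_nonneg (by
          rw [← neg_div]; exact div_nonneg (by linarith) hτ.le) hD0
        exact ⟨by linarith, by linarith, fun _ => this⟩
      · have hS0 : 0 ≤ σ / τ := div_nonneg hpos hτ.le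
        refine ⟨by nlinarith, by linarith, fun hcon => absurd hcon (not_lt.mpr ?_)⟩
        -- The angle is below `2 π`, so a nonnegative sine puts it in `[0, π]`. The next, smaller
        -- angle stays there, so `σ` never becomes negative again.
        have hle : ((2 * t + 1 : ℕ) - (i : ℝ)) * φ ≤ Real.pi := by
          by_contra! hgt
          have h5 : Real.sin (((2 * t + 1 : ℕ) - (i : ℝ)) * φ - 2 * Real.pi) < 0 :=
            Real.sin_neg_of_neg_of_neg_pi_lt (by push_cast; nlinarith) (by linarith)
          rw [Real.sin_sub_two_pi] at h5
          linarith
        push_cast at hle ⊢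
        exact Real.sin_nonneg_of_nonneg_of_le_pi (mul_nonneg (by linarith) hφ0.le) (by nlinarith)
  rcases le_total i t with h | h
  · exact (main i h).1
  · rw [← sinAlt_symm hφ hi]
    exact (main _ (by omega)).1

/-- Here `cos ((t + 1) φ) > 0`, so the binomials increase up to the middle and their alternating
sums take the sign of the last term. -/
theorem neg_one_pow_mul_sinAlt_pos {t : ℕ} {φ : ℝ}
    (hφ : ∀ i, 0 < i → i ≤ 2 * t + 1 → Real.sin (i * φ) ≠ 0)
    (hφ0 : 0 < φ) (h2 : (t + 1) * φ < Real.pi / 2) {i : ℕ}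
    (hi : i ≤ 2 * t) : 0 < (-1) ^ i * sinAlt t φ i := by
  have hB : ∀ i ≤ 2 * t + 1, 0 < sinBinom (2 * t + 1) φ i := fun i hi =>
    sinBinom_pos hφ0 (by push_cast; linarith) hi
  have main : ∀ i ≤ t, 0 < (-1) ^ i * sinAlt t φ i ∧
      (-1) ^ i * sinAlt t φ i ≤ sinBinom (2 * t + 1) φ i := by
    intro i
    induction i with
    | zero => simp [sinAlt_zero, sinBinom_zero]
    | succ i ih =>
      intro hi
      obtain ⟨e0, e1⟩ := ih (by omega)
      have hit : (i : ℝ) + 1 ≤ t := by exact_mod_cast hi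
      have hi0 : (0 : ℝ) ≤ i := i.cast_nonneg
      have hτ : 0 < Real.sin (((i : ℝ) + 1) * φ) :=
        Real.sin_pos_of_pos_of_lt_pi (by positivity) (by nlinarith)
      have hlt : Real.sin (((i : ℝ) + 1) * φ) < Real.sin (((2 * t + 1 : ℕ) - (i : ℝ)) * φ) := by
        have h := sin_sub_sin_reflect t i φ
        have h3 : 0 < Real.sin (((t : ℝ) - i) * φ) :=
          Real.sin_pos_of_pos_of_lt_pi (mul_pos (by linarith) hφ0) (by nlinarith)
        have h4 : 0 < Real.cos (((t : ℝ) + 1) * φ) :=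
          Real.cos_pos_of_mem_Ioo ⟨by nlinarith [Real.pi_pos], h2⟩
        nlinarith [mul_pos h3 h4]
      have hB1 : sinBinom (2 * t + 1) φ i < sinBinom (2 * t + 1) φ (i + 1) := by
        rw [sinBinom_succ]
        exact lt_mul_of_one_lt_right (hB i (by omega)) ((one_lt_div hτ).mpr hlt)
      have hg : (-1) ^ (i + 1) * sinAlt t φ (i + 1) =
          sinBinom (2 * t + 1) φ (i + 1) - (-1) ^ i * sinAlt t φ i := by
        rw [sinAlt_succ, mul_add, ← mul_assoc, ← pow_add, Even.neg_one_pow ⟨i + 1, rfl⟩]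
        ring
      rw [hg]
      exact ⟨by linarith, by linarith⟩
  rcases le_total i t with h | h
  · exact (main i h).1
  · have := (main (2 * t - i) (by omega)).1
    rwa [sinAlt_symm hφ hi, neg_one_pow_congr (n := i) (by rw [Nat.even_sub hi]; simp)] at this

/-! ### Roots of unity and minimal families -/

theorem sin_pi_mul_div_ne_zero {k u : ℕ} (h : Nat.Coprime k u) {i : ℕ} (hi : 0 < i) (hik : i < k) :
    Real.sin (i * (Real.pi * u / k)) ≠ 0 := by
  intro h0
  obtain ⟨n, hn⟩ := Real.sin_eq_zero_iff.mp h0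
  have hk : (k : ℝ) ≠ 0 := by
    have : 0 < k := by omega
    positivity
  have h1 : (n * k : ℝ) = i * u := by
    have := Real.pi_ne_zero
    field_simp at hn
    exact hn
  have h2 : (n * k : ℤ) = i * u := by exact_mod_cast h1
  have h3 : k ∣ i * u := by
    have : (k : ℤ) ∣ ((i * u : ℕ) : ℤ) := ⟨n, by push_cast; rw [← h2]; ring⟩
    exact_mod_cast this
  exact absurd (Nat.le_of_dvd hi (h.dvd_of_dvd_mul_right h3)) (by omega)

theorem exp_pi_mul_div_pow {k u : ℕ} (hk : 0 < k) :
    Complex.exp (((Real.pi * u / k : ℝ) : ℂ) * Complex.I) ^ k = (-1) ^ u := by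
  have hk' : (k : ℂ) ≠ 0 := by exact_mod_cast hk.ne'
  rw [← Complex.exp_nat_mul, ← Complex.exp_pi_mul_I, ← Complex.exp_nat_mul]
  congr 1
  push_cast
  field_simp

theorem norm_exp_mul_I_sq (φ : ℝ) : ‖Complex.exp (φ * Complex.I) ^ 2‖ = 1 := by
  rw [norm_pow, Complex.norm_exp_ofReal_mul_I, one_pow]

theorem sum_sinAlt_pow_eq_zero {t k u δ : ℕ} (hu : Nat.Coprime k u) (hk : 2 * t + 1 < k)
    (hδ0 : 0 < δ) (hδk : δ < k) (hδ : δ ≤ t ∨ k ≤ δ + t) :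
    ∑ i ∈ Finset.range (2 * t + 1), (sinAlt t (Real.pi * u / k) i : ℂ) *
      ((Complex.exp (((Real.pi * u / k : ℝ) : ℂ) * Complex.I) ^ 2) ^ δ) ^ i = 0 := by
  have hs : ∀ i, 0 < i → i < k → Real.sin (i * (Real.pi * u / k)) ≠ 0 :=
    fun i hi hik => sin_pi_mul_div_ne_zero hu hi hik
  have hne : (Complex.exp (((Real.pi * u / k : ℝ) : ℂ) * Complex.I) ^ 2) ^ δ ≠ 1 := by
    rw [← pow_mul]
    exact exp_pow_two_mul_ne_one (hs δ hδ0 hδk)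
  rcases hδ with h | h
  · exact sum_sinAlt_eq_zero (fun i hi hik => hs i hi (by omega)) rfl (c := t + δ) (by omega)
      (by ring) hne
  · refine sum_sinAlt_eq_zero (fun i hi hik => hs i hi (by omega)) rfl (c := t + δ - k) (by omega)
      ?_ hne
    obtain ⟨c, hc⟩ := Nat.exists_eq_add_of_le h
    rw [show t + δ - k = c by omega, ← pow_mul, ← pow_add,
      show 2 * δ + 2 * t = 2 * c + k * 2 by omega, pow_add, pow_mul _ k 2,
      exp_pi_mul_div_pow (by omega), ← pow_mul, mul_comm u, pow_mul]
    norm_num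

/-- The bounds on `u` place `(t + 1) * (π u / k)` strictly between `π / 2` and `π`, as `sinAlt_pos`
requires. The second factor uses `u = 1` and a plain binomial, whose `n - 1` zeros are the middle
differences. -/
theorem bipartiteMissing_odd_left {t n k u : ℕ} (hn : 2 ≤ n) (hk : k = 2 * t + n)
    (hu : Nat.Coprime k u) (h1 : k < u * (2 * t + 2)) (h2 : u * (t + 1) < k) :
    BipartiteMissing (2 * t + 1) n (2 * t * (n - 1)) := by
  have hk0 : (0 : ℝ) < k := by
    have : 0 < k := by omega
    exact_mod_cast this
  have hu0 : (0 : ℝ) < u := by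
    rcases Nat.eq_zero_or_pos u with h | h
    · simp [h] at h1
    · exact_mod_cast h
  have hkk : 2 * t + 1 + n - 1 = k := by omega
  have hs1 : ∀ i, 0 < i → i < k → Real.sin (i * (Real.pi * (1 : ℕ) / k)) ≠ 0 :=
    fun i hi hik => sin_pi_mul_div_ne_zero (Nat.coprime_one_right k) hi hik
  have hs : ∀ i, 0 < i → i < k → Real.sin (i * (Real.pi * u / k)) ≠ 0 :=
    fun i hi hik => sin_pi_mul_div_ne_zero hu hi hik
  have h1' : (k : ℝ) < u * (2 * t + 2) := by exact_mod_cast h1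
  have h2' : (u * (t + 1) : ℝ) < k := by exact_mod_cast h2
  have hpi := Real.pi_pos
  refine bipartiteMissing_of_weights (a := sinAlt t (Real.pi * u / k))
    (b := sinBinom (n - 1) (Real.pi * (1 : ℕ) / k)) (by omega) (by omega) (fun x hx => ?_)
    (fun y hy => ?_) (norm_exp_mul_I_sq (Real.pi * u / k))
    (norm_exp_mul_I_sq (Real.pi * (1 : ℕ) / k)) ?_ ?_ ?_
  · refine sinAlt_pos (fun i hi hik => hs i hi (by omega)) (by positivity) ?_ ?_ (by omega)
    · rw [mul_div_assoc', lt_div_iff₀ hk0]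
      nlinarith
    · rw [mul_div_assoc', div_lt_iff₀ hk0]
      nlinarith
  · refine sinBinom_pos (by positivity) ?_ (by omega)
    rw [mul_div_assoc', div_lt_iff₀ hk0]
    have : ((n - 1 : ℕ) : ℝ) < k := by exact_mod_cast (by omega : n - 1 < k)
    push_cast
    nlinarith
  · intro δ h0 hδ
    rw [← pow_mul]
    exact exp_pow_two_mul_ne_one (hs δ h0 (by omega))
  · intro δ h0 hδ
    rw [← pow_mul]
    exact exp_pow_two_mul_ne_one (hs1 δ h0 (by omega))
  · intro δ h0 hδ
    by_cases hc : δ ≤ t ∨ k ≤ δ + t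
    · exact Or.inl (sum_sinAlt_pow_eq_zero hu (by omega) h0 (by omega) hc)
    · right
      push Not at hc
      obtain ⟨c, rfl⟩ := Nat.exists_eq_add_of_lt hc.1
      have h := sum_sinBinom_eq_zero (N := n - 1) (φ := Real.pi * (1 : ℕ) / k)
        (fun i hi hik => hs1 i hi (by omega)) rfl (c := c) (by omega)
      rw [show n - 1 + 1 = n by omega] at h
      rw [← h]
      set ζ := Complex.exp (((Real.pi * (1 : ℕ) / k : ℝ) : ℂ) * Complex.I) with hζ
      have hζ0 : ζ ≠ 0 := Complex.exp_ne_zero _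
      have hζk : ζ ^ k = -1 := by rw [hζ, exp_pi_mul_div_pow (by omega), pow_one]
      have : (ζ ^ 2) ^ (t + c + 1) = -(ζ ^ (2 * c) * ζ * ζ⁻¹ ^ (n - 1)) := by
        apply mul_right_cancel₀ (pow_ne_zero (n - 1) hζ0)
        rw [neg_mul, mul_assoc, ← mul_pow, inv_mul_cancel₀ hζ0, one_pow, mul_one, ← pow_mul,
          ← pow_add, show 2 * (t + c + 1) + (n - 1) = 2 * c + 1 + k by omega, pow_add, hζk, pow_succ]
        ring
      rw [this]

/-- Now `k` is even and `u` odd. The even-dimensional factor uses the `sinAlt` polynomial times `1 +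
z`, which also vanishes at `δ = k / 2`. The odd one uses `sinAlt` with alternating signs: its zeros,
negated, are the middle differences without `k / 2`. -/
theorem bipartiteMissing_odd_even {s t k u : ℕ} (ht : 0 < t) (hk : k = 2 * s + 2 * t + 2)
    (hu : Nat.Coprime k u) (h1 : k < u * (2 * t + 2)) (h2 : u * (t + 1) < k) :
    BipartiteMissing (2 * s + 1) (2 * t + 2) (2 * s * (2 * t + 1)) := by
  have hk0 : (0 : ℝ) < k := by
    have : 0 < k := by omega
    exact_mod_cast this
  have hu0 : (0 : ℝ) < u := by
    rcases Nat.eq_zero_or_pos u with h | h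
    · simp [h] at h1
    · exact_mod_cast h
  have huo : Odd u := by
    rw [← Nat.coprime_two_left]
    exact Nat.Coprime.coprime_dvd_left (by omega) hu
  have hkk : 2 * s + 1 + (2 * t + 2) - 1 = k := by omega
  have hs1 : ∀ i, 0 < i → i < k → Real.sin (i * (Real.pi * (1 : ℕ) / k)) ≠ 0 :=
    fun i hi hik => sin_pi_mul_div_ne_zero (Nat.coprime_one_right k) hi hik
  have hs : ∀ i, 0 < i → i < k → Real.sin (i * (Real.pi * u / k)) ≠ 0 :=
    fun i hi hik => sin_pi_mul_div_ne_zero hu hi hik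
  have h1' : (k : ℝ) < u * (2 * t + 2) := by exact_mod_cast h1
  have h2' : (u * (t + 1) : ℝ) < k := by exact_mod_cast h2
  have hpi := Real.pi_pos
  have hpos : ∀ i ≤ 2 * t, 0 < sinAlt t (Real.pi * u / k) i := by
    intro i hi
    refine sinAlt_pos (fun i hi hik => hs i hi (by omega)) (by positivity) ?_ ?_ hi
    · rw [mul_div_assoc', lt_div_iff₀ hk0]
      nlinarith
    · rw [mul_div_assoc', div_lt_iff₀ hk0]
      nlinarith
  refine bipartiteMissing_of_weights (a := fun i => (-1) ^ i * sinAlt s (Real.pi * (1 : ℕ) / k) i)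
    (b := fun i => (if i ≤ 2 * t then sinAlt t (Real.pi * u / k) i else 0) +
      (if 1 ≤ i then sinAlt t (Real.pi * u / k) (i - 1) else 0))
    (by omega) (by omega) (fun x hx => ?_) (fun y hy => ?_)
    (norm_exp_mul_I_sq (Real.pi * (1 : ℕ) / k)) (norm_exp_mul_I_sq (Real.pi * u / k)) ?_ ?_ ?_
  · refine neg_one_pow_mul_sinAlt_pos (fun i hi hik => hs1 i hi (by omega)) (by positivity) ?_
      (by omega)
    rw [mul_div_assoc', div_lt_iff₀ hk0]
    have : (2 * s + 2 : ℝ) < k := by exact_mod_cast (by omega : 2 * s + 2 < k)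
    push_cast
    nlinarith
  · by_cases hy1 : y ≤ 2 * t
    · by_cases hy0 : 1 ≤ y
      · rw [if_pos hy1, if_pos hy0]
        exact add_pos (hpos _ hy1) (hpos _ (by omega))
      · rw [if_pos hy1, if_neg hy0, add_zero]
        exact hpos _ hy1
    · rw [if_neg hy1, if_pos (by omega), zero_add]
      exact hpos _ (by omega)
  · intro δ h0 hδ
    rw [← pow_mul]
    exact exp_pow_two_mul_ne_one (hs1 δ h0 (by omega))
  · intro δ h0 hδ
    rw [← pow_mul]
    exact exp_pow_two_mul_ne_one (hs δ h0 (by omega))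
  · intro δ h0 hδ
    have hfac : ∀ z : ℂ, ∑ i ∈ Finset.range (2 * t + 2),
        ((((if i ≤ 2 * t then sinAlt t (Real.pi * u / k) i else 0) +
          (if 1 ≤ i then sinAlt t (Real.pi * u / k) (i - 1) else 0) : ℝ)) : ℂ) * z ^ i =
        (1 + z) * ∑ i ∈ Finset.range (2 * t + 1), (sinAlt t (Real.pi * u / k) i : ℂ) * z ^ i := by
      intro z
      simp only [Complex.ofReal_add, add_mul, Finset.sum_add_distrib, one_mul]
      congr 1
      · rw [Finset.sum_range_succ, if_neg (by omega)]
        simp only [Complex.ofReal_zero, zero_mul, add_zero]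
        refine Finset.sum_congr rfl fun i hi => ?_
        rw [if_pos (by have := Finset.mem_range.mp hi; omega)]
      · rw [Finset.sum_range_succ', Finset.mul_sum]
        simp only [nonpos_iff_eq_zero, one_ne_zero, if_false, Complex.ofReal_zero, zero_mul,
          add_zero, Nat.add_sub_cancel]
        refine Finset.sum_congr rfl fun i hi => ?_
        rw [if_pos (by omega), pow_succ]
        ring
    by_cases hc : δ ≤ t ∨ k ≤ δ + t
    · right
      rw [hfac, sum_sinAlt_pow_eq_zero hu (by omega) h0 (by omega) hc, mul_zero]
    by_cases hmid : δ = s + t + 1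
    · right
      rw [hfac, ← pow_mul, hmid, show 2 * (s + t + 1) = k by omega, exp_pi_mul_div_pow (by omega),
        huo.neg_one_pow]
      simp
    · left
      push Not at hc
      set ζ := Complex.exp (((Real.pi * (1 : ℕ) / k : ℝ) : ℂ) * Complex.I) with hζ
      have hζ0 : ζ ≠ 0 := Complex.exp_ne_zero _
      have hζk : ζ ^ k = -1 := by rw [hζ, exp_pi_mul_div_pow (by omega), pow_one]
      have h := sum_sinAlt_eq_zero (t := s) (φ := Real.pi * (1 : ℕ) / k)
        (fun i hi hik => hs1 i hi (by omega)) hζ (c := δ - t - 1) (by omega)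
        (z := -(ζ ^ 2) ^ δ) (by
          obtain ⟨c, rfl⟩ := Nat.exists_eq_add_of_lt hc.1
          rw [show t + c + 1 - t - 1 = c by omega, ← pow_mul, neg_mul, ← pow_add,
            show 2 * (t + c + 1) + 2 * s = 2 * c + k by omega, pow_add, hζk]
          ring) (by
          intro h
          have h' : ζ ^ (2 * δ) = ζ ^ (2 * (s + t + 1)) := by
            rw [show 2 * (s + t + 1) = k by omega, hζk, pow_mul, ← h, neg_neg]
          rcases lt_or_gt_of_ne hmid with hlt | hlt
          · obtain ⟨r, hr⟩ := Nat.exists_eq_add_of_lt hlt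
            rw [hr, add_assoc, mul_add, pow_add] at h'
            exact exp_pow_two_mul_ne_one (hs1 (r + 1) (by omega) (by omega))
              (mul_left_cancel₀ (pow_ne_zero (2 * δ) hζ0) (by rw [mul_one]; exact h'.symm))
          · obtain ⟨r, hr⟩ := Nat.exists_eq_add_of_lt hlt
            rw [hr, add_assoc, mul_add, pow_add] at h'
            exact exp_pow_two_mul_ne_one (hs1 (r + 1) (by omega) (by omega))
              (mul_left_cancel₀ (pow_ne_zero (2 * (s + t + 1)) hζ0) (by rw [mul_one]; exact h')))
      rw [← h]
      refine Finset.sum_congr rfl fun i _ => ?_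
      rw [neg_pow ((ζ ^ 2) ^ δ)]
      push_cast
      ring

/-! ### Small explicit families -/

/-- Orthogonality of integer vectors is decidable. -/
theorem bipartiteMissing_of_int {k m n s : ℕ} (v : Fin k → Fin m → ℤ) (w : Fin k → Fin n → ℤ)
    (hv : ∀ j, v j ≠ 0) (hw : ∀ j, w j ≠ 0)
    (ho : ∀ j l, j ≠ l → ∑ x, v j x * v l x = 0 ∨ ∑ y, w j y * w l y = 0)
    (hu : ∀ (f : Fin m → ℂ) (g : Fin n → ℂ),
      (∀ j, (∑ x, (v j x : ℂ) * f x) * ∑ y, (w j y : ℂ) * g y = 0) → f = 0 ∨ g = 0)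
    (hc : k + s = m * n) : BipartiteMissing m n s := by
  have hne : ∀ {m : ℕ} (u : Fin m → ℤ), u ≠ 0 → (fun x => (u x : ℂ)) ≠ 0 := by
    intro m u hu h
    apply hu
    funext x
    have := congrFun h x
    simpa using this
  have hdot : ∀ {m : ℕ} (u : Fin m → ℤ) (f : Fin m → ℂ),
      star (fun x => (u x : ℂ)) ⬝ᵥ f = ∑ x, (u x : ℂ) * f x := by
    intro m u f
    simp [dotProduct]
  refine ⟨Fin k, inferInstance, fun j x => v j x, fun j y => w j y, fun j => hne _ (hv j),
    fun j => hne _ (hw j), fun j l hjl => ?_, fun f g hf hg => ?_, by simpa using hc⟩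
  · rw [hdot, hdot]
    have := ho j l hjl
    beta_reduce
    exact_mod_cast this
  · by_contra! hcon
    rcases hu f g fun j => by
      rw [← hdot, ← hdot, mul_eq_zero]
      exact or_iff_not_imp_left.mpr (hcon j) with h | h
    · exact hf h
    · exact hg h

theorem bipartiteMissing_three_four_five : BipartiteMissing 3 4 5 := by
  refine bipartiteMissing_of_int (k := 7)
    ![![1, 0, 0], ![1, -1, 0], ![1, 0, -1], ![0, 1, 0], ![0, 1, -1], ![0, 0, 1], ![1, 1, 1]]
    ![![1, -1, 0, 0], ![0, 0, 1, 0], ![0, 0, 0, 1], ![1, 0, 0, -1], ![0, 1, 0, 0], ![1, 0, -1, 0],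
      ![1, 1, 1, 1]] (by decide) (by decide) (by decide) (fun f g h => ?_) (by norm_num)
  simp only [Fin.forall_fin_succ, Fin.sum_univ_succ] at h
  simp at h
  simp only [funext_iff, Fin.forall_fin_succ]
  simp
  grind

theorem bipartiteMissing_four_four_six : BipartiteMissing 4 4 6 := by
  refine bipartiteMissing_of_int (k := 10)
    ![![1, -1, 0, 0], ![1, 0, -1, 0], ![1, 0, 0, -1], ![0, 1, 0, 0], ![0, 1, 0, 0], ![0, 0, 1, 0],
      ![0, 0, 1, 0], ![0, 0, 0, 1], ![0, 0, 0, 1], ![1, 1, 1, 1]]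
    ![![0, 1, 0, 0], ![0, 0, 1, 0], ![0, 0, 0, 1], ![1, 0, -1, 0], ![1, 0, 1, -2], ![1, -1, 0, 0],
      ![1, 1, 0, -2], ![1, -1, 0, 0], ![1, 1, -2, 0], ![1, 1, 1, 1]]
    (by decide) (by decide) (by decide) (fun f g h => ?_) (by norm_num)
  simp only [Fin.forall_fin_succ, Fin.sum_univ_succ] at h
  simp at h
  simp only [funext_iff, Fin.forall_fin_succ]
  simp
  grind

theorem bipartiteMissing_four_four_seven : BipartiteMissing 4 4 7 := by
  refine bipartiteMissing_of_int (k := 9)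
    ![![1, 0, 0, 0], ![1, -1, 0, 0], ![1, 0, -1, 0], ![0, 1, 0, 0], ![0, 1, 0, -1], ![0, 0, 1, -1],
      ![0, 0, 1, 0], ![0, 0, 0, 1], ![1, 1, 1, 1]]
    ![![1, -1, 0, 0], ![0, 0, 1, 0], ![0, 0, 0, 1], ![1, 0, 0, -1], ![0, 1, 0, 0], ![1, 0, 0, 0],
      ![0, 1, -1, 0], ![0, 0, 1, -1], ![1, 1, 1, 1]]
    (by decide) (by decide) (by decide) (fun f g h => ?_) (by norm_num)
  simp only [Fin.forall_fin_succ, Fin.sum_univ_succ] at h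
  simp at h
  simp only [funext_iff, Fin.forall_fin_succ]
  simp
  grind

/-! ### Choosing the root of unity -/

/-- Minimal families for two odd dimensions. -/
theorem bipartiteMissing_odd_odd {t n : ℕ} (hn : 3 ≤ n) (hno : Odd n) :
    BipartiteMissing (2 * t + 1) n (2 * t * (n - 1)) := by
  rcases Nat.eq_zero_or_pos t with rfl | ht
  · simpa using BipartiteMissing.zero 1 n
  have hko : Odd (2 * t + n) := (even_two_mul t).add_odd hno
  have hex : ∃ i, 2 * t + n < 2 ^ i * (2 * t + 2) :=
    ⟨2 * t + n, by nlinarith [Nat.lt_two_pow_self (n := 2 * t + n)]⟩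
  classical
  have h1 := Nat.find_spec hex
  set i := Nat.find hex with hi
  have hi0 : i ≠ 0 := by
    intro h
    rw [h] at h1
    simp at h1
    omega
  obtain ⟨j, hj⟩ := Nat.exists_eq_succ_of_ne_zero hi0
  -- Minimality gives `u * (t + 1) ≤ k` for `u = 2 ^ i`; equality would make the odd number `k`
  -- even.
  have h2 := Nat.find_min hex (m := j) (by omega)
  refine bipartiteMissing_odd_left (u := 2 ^ i) (by omega) rfl
    (Nat.Coprime.pow_right _ (Nat.coprime_two_right.mpr hko)) h1 ?_
  have h3 : 2 ^ i * (t + 1) = 2 ^ j * (2 * t + 2) := by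
    rw [hj, pow_succ]; ring
  rw [h3]
  refine lt_of_le_of_ne (not_lt.mp h2) fun h4 => ?_
  rw [← h4] at hko
  exact absurd hko (Nat.not_odd_iff_even.mpr ⟨2 ^ j * (t + 1), by ring⟩)

/-- Minimal families for an even dimension and one of two consecutive larger odd dimensions. -/
theorem bipartiteMissing_odd_even_or {s t : ℕ} (ht : 0 < t) (hst : t < s) :
    BipartiteMissing (2 * s + 1) (2 * t + 2) (2 * s * (2 * t + 1)) ∨
    BipartiteMissing (2 * s + 3) (2 * t + 2) ((2 * s + 2) * (2 * t + 1)) := by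
  set k := 2 * s + 2 * t + 2 with hk
  set a := k / (2 * t + 2) with ha
  have ha1 : a * (2 * t + 2) ≤ k := Nat.div_mul_le_self _ _
  have ha2 : k < (a + 1) * (2 * t + 2) :=
    (Nat.div_lt_iff_lt_mul (by omega)).mp (Nat.lt_succ_self _)
  have ha3 : 2 ≤ a := (Nat.le_div_iff_mul_le (by omega)).mpr (by omega)
  -- Bertrand's postulate: `a < u < 2 * a` yields both bounds on `u`. Since `u ≥ 3`, it cannot
  -- divide both `k` and `k + 2`, so one of the two widths works.
  obtain ⟨u, hu, hau, hua⟩ := Nat.exists_prime_lt_and_le_two_mul a (by omega)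
  have hu2 : u ≠ 2 * a := by
    rintro rfl
    exact Nat.not_prime_mul (by norm_num) (by omega) hu
  have hu3 : 3 ≤ u := by omega
  have hlow : k < u * (2 * t + 2) := ha2.trans_le (Nat.mul_le_mul_right _ hau)
  have hup : u * (t + 1) < k := by
    have : u * (t + 1) < 2 * a * (t + 1) := Nat.mul_lt_mul_of_pos_right (by omega) (by omega)
    nlinarith
  by_cases huk : u ∣ k
  · right
    have huk2 : ¬ u ∣ k + 2 := fun h => by
      have := Nat.le_of_dvd (by norm_num) ((Nat.dvd_add_right huk).mp h)
      omega
    refine bipartiteMissing_odd_even (s := s + 1) ht (k := k + 2) (by omega)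
      ((Nat.Prime.coprime_iff_not_dvd hu).mpr huk2).symm ?_ (by omega)
    obtain ⟨q, hq⟩ := huk
    have h1 : q < 2 * t + 2 := by
      rw [hq] at hlow
      exact lt_of_mul_lt_mul_left hlow (Nat.zero_le _)
    have h2 : u * (q + 1) ≤ u * (2 * t + 2) := Nat.mul_le_mul_left _ h1
    rw [mul_add, ← hq] at h2
    omega
  · left
    exact bipartiteMissing_odd_even ht hk ((Nat.Prime.coprime_iff_not_dvd hu).mpr huk).symm hlow hup

/-! ### Filling the interval with blocks -/

theorem bipartiteMissing_four_four {c : ℕ} (h4 : 4 ≤ c) (h7 : c ≤ 7) : BipartiteMissing 4 4 c := by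
  interval_cases c
  · exact (bipartiteMissing_odd_odd (t := 1) (n := 3) le_rfl (by decide)).mono (by norm_num)
      (by norm_num)
  · exact bipartiteMissing_three_four_five.mono (by norm_num) le_rfl
  · exact bipartiteMissing_four_four_six
  · exact bipartiteMissing_four_four_seven

theorem bipartiteMissing_three_mul {n j : ℕ} (h : 2 * j + 1 ≤ n) : BipartiteMissing 3 n (4 * j) := by
  rcases Nat.eq_zero_or_pos j with rfl | hj
  · exact BipartiteMissing.zero 3 n
  · have := bipartiteMissing_odd_odd (t := 1) (n := 2 * j + 1) (by omega) ⟨j, rfl⟩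
    rw [show 2 * 1 * (2 * j + 1 - 1) = 4 * j by omega] at this
    exact this.mono le_rfl h

/-- Width 7 is `4 + 3`: the width-4 block fixes the residue modulo 4 and the width-3 block supplies
a multiple of 4. -/
theorem bipartiteMissing_of_seven_le {r n x : ℕ} (hr : 7 ≤ r) (hn : 4 ≤ n) (h4 : 4 ≤ x)
    (hx : x ≤ 2 * n + 3) : BipartiteMissing r n x := by
  have h1 := bipartiteMissing_four_four (c := 4 + x % 4) (by omega) (by omega)
  have h2 := bipartiteMissing_three_mul (n := n) (j := x / 4 - 1) (by omega)
  have h3 := (h1.mono le_rfl hn).add_left h2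
  rw [show 4 + x % 4 + 4 * (x / 4 - 1) = x by omega] at h3
  exact h3.mono hr le_rfl

theorem bipartiteMissing_of_ten_le {r n x : ℕ} (hr : 10 ≤ r) (hn : 4 ≤ n) (h4 : 4 ≤ x)
    (hx : x ≤ 4 * n - 1) : BipartiteMissing r n x := by
  by_cases hx' : x ≤ 2 * n + 3
  · exact bipartiteMissing_of_seven_le (by omega) hn h4 hx'
  · have h1 := bipartiteMissing_of_seven_le (r := 7) (n := n) (x := x - 4 * ((n - 1) / 2)) le_rfl hn
      (by omega) (by omega)
    have h2 := bipartiteMissing_three_mul (n := n) (j := (n - 1) / 2) (by omega)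
    have h3 := h1.add_left h2
    rw [show x - 4 * ((n - 1) / 2) + 4 * ((n - 1) / 2) = x by omega] at h3
    exact h3.mono hr le_rfl

/-- Blocks of odd width `2 t + 1` and odd height `n'`, the remainder filled by small blocks. -/
theorem bipartiteMissing_of_odd_height {m n n' s T : ℕ} (hn : 4 ≤ n) (hn' : 3 ≤ n') (hno : Odd n')
    (hnn : n' ≤ n) (h4 : 4 ≤ s) (hT : 2 * T + 8 ≤ m)
    (hs : s ≤ 2 * T * (n' - 1) + (2 * n + 3)) : BipartiteMissing m n s := by
  induction T with
  | zero => exact bipartiteMissing_of_seven_le (by omega) hn h4 (by omega)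
  | succ T ih =>
    by_cases h : 2 * (T + 1) * (n' - 1) + 4 ≤ s
    · have h1 := (bipartiteMissing_odd_odd (t := T + 1) hn' hno).mono le_rfl hnn
      have h2 := bipartiteMissing_of_seven_le (r := 7) (n := n) (x := s - 2 * (T + 1) * (n' - 1))
        le_rfl hn (by omega) (by omega)
      have h3 := h1.add_left h2
      rw [Nat.add_sub_cancel' (by omega)] at h3
      exact h3.mono (by omega) le_rfl
    · refine ih (by omega) ?_
      have : 2 * (T + 1) * (n' - 1) = 2 * T * (n' - 1) + 2 * (n' - 1) := by ring
      omega

/-- The large block has width `2 * q - 1` or `2 * q + 1`, whichever the arithmetic allows. The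
remaining width is then at least 10 or 8, enough for the rest, which is at most `4 * n - 1` or `2 *
n + 1`. -/
theorem bipartiteMissing_of_even_height {m n s q : ℕ} (hn : 4 ≤ n) (hne : Even n)
    (hq : n < 2 * q) (hm : 2 * q + 9 ≤ m) (h1 : 2 * q * (n - 1) + 4 ≤ s)
    (h2 : s ≤ 2 * q * (n - 1) + (2 * n + 1)) : BipartiteMissing m n s := by
  obtain ⟨t, rfl⟩ : ∃ t, n = 2 * t + 2 := by
    obtain ⟨r, rfl⟩ := hne
    exact ⟨r - 1, by omega⟩
  obtain ⟨q, rfl⟩ := Nat.exists_eq_add_of_le' (by omega : 1 ≤ q)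
  rw [show 2 * t + 2 - 1 = 2 * t + 1 by omega] at h1 h2
  have hmul : 2 * (q + 1) * (2 * t + 1) = 2 * q * (2 * t + 1) + 2 * (2 * t + 1) := by ring
  rcases bipartiteMissing_odd_even_or (s := q) (t := t) (by omega) (by omega) with h | h
  · have h3 := bipartiteMissing_of_ten_le (r := 10) (n := 2 * t + 2)
      (x := s - 2 * q * (2 * t + 1)) le_rfl hn (by omega) (by omega)
    have h4 := h.add_left h3
    rw [Nat.add_sub_cancel' (by omega)] at h4
    exact h4.mono (by omega) le_rfl
  · have h3 := bipartiteMissing_of_seven_le (r := 7) (n := 2 * t + 2)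
      (x := s - 2 * (q + 1) * (2 * t + 1)) le_rfl hn (by omega) (by omega)
    have h4 := h.add_left h3
    rw [show (2 * q + 2) * (2 * t + 1) = 2 * (q + 1) * (2 * t + 1) by ring,
      Nat.add_sub_cancel' (by omega)] at h4
    exact h4.mono (by omega) le_rfl

theorem bipartiteMissing_of_le {m n s : ℕ} (hm : 10 ≤ m) (hn : 4 ≤ n) (h4 : 4 ≤ s)
    (hs : s ≤ (m - 8) * (n - 1)) : BipartiteMissing m n s := by
  obtain ⟨M, rfl⟩ := Nat.exists_eq_add_of_le hm
  obtain ⟨n, rfl⟩ := Nat.exists_eq_add_of_le' hn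
  have hM : M + 2 ≤ 2 * ((M + 2) / 2) + 1 := by omega
  rw [show 10 + M - 8 = M + 2 by omega, show n + 4 - 1 = n + 3 by omega] at hs
  rcases Nat.even_or_odd (n + 4) with he | ho
  · by_cases hsmall : s ≤ 2 * ((M + 2) / 2) * (n + 2) + (2 * (n + 4) + 3)
    · exact bipartiteMissing_of_odd_height (n' := n + 3) (T := (M + 2) / 2) hn (by omega)
        (by grind) (by omega) h4 (by omega) hsmall
    · have h1 : (M + 1) * (n + 2) ≤ 2 * ((M + 2) / 2) * (n + 2) :=
        Nat.mul_le_mul_right _ (by omega)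
      -- Blocks of the odd height one below fall short only when the first dimension is large
      -- compared with the second; this gives the `q` below the size needed for Bertrand.
      have hMn : n + 8 ≤ M := by nlinarith
      obtain ⟨q, hq⟩ : ∃ q, q = (s - 4) / (2 * (n + 3)) := ⟨_, rfl⟩
      have hq1 : q * (2 * (n + 3)) ≤ s - 4 := hq ▸ Nat.div_mul_le_self _ _
      have hq2 : s - 4 < (q + 1) * (2 * (n + 3)) :=
        (Nat.div_lt_iff_lt_mul (by omega)).mp (hq ▸ Nat.lt_succ_self _)
      have e1 : 2 * q * (n + 3) = q * (2 * (n + 3)) := by ring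
      have e2 : (q + 1) * (2 * (n + 3)) = q * (2 * (n + 3)) + 2 * (n + 3) := by ring
      refine bipartiteMissing_of_even_height (q := q) hn he ?_ ?_ ?_ ?_
      · have h2 : (n + 9) * (n + 2) ≤ (M + 1) * (n + 2) := Nat.mul_le_mul_right _ (by omega)
        have h3 : (n + 8) * (n + 3) < (2 * q + 2) * (n + 3) := by
          have e3 : (n + 9) * (n + 2) + 6 = (n + 8) * (n + 3) := by ring
          have e4 : (2 * q + 2) * (n + 3) = (q + 1) * (2 * (n + 3)) := by ring
          omega
        have := lt_of_mul_lt_mul_right h3 (Nat.zero_le _)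
        omega
      · have h2 : 2 * q * (n + 3) < (M + 2) * (n + 3) := by omega
        have := lt_of_mul_lt_mul_right h2 (Nat.zero_le _)
        omega
      · rw [show n + 4 - 1 = n + 3 by omega]
        omega
      · rw [show n + 4 - 1 = n + 3 by omega]
        omega
  · have := Nat.mul_le_mul_right (n + 3) hM
    rw [add_mul (2 * ((M + 2) / 2))] at this
    refine bipartiteMissing_of_odd_height (n' := n + 4) (T := (M + 2) / 2) hn (by omega) ho le_rfl
      h4 (by omega) ?_
    rw [show n + 4 - 1 = n + 3 by omega]
    omega

/-! ### Distributing the missing number -/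

/-- Numbers up to `P * K` are sums of `P` numbers in `{0} ∪ [4, K]`. -/
theorem exists_sum_eq_of_le {κ : Type} [Fintype κ] {K s : ℕ} (hK : 7 ≤ K) (h4 : 4 ≤ s)
    (hs : s ≤ K * Fintype.card κ) :
    ∃ f : κ → ℕ, (∀ x, f x = 0 ∨ (4 ≤ f x ∧ f x ≤ K)) ∧ ∑ x, f x = s := by
  classical
  have main : ∀ (S : Finset κ) (s : ℕ), 4 ≤ s → s ≤ K * S.card →
      ∃ f : κ → ℕ, (∀ x, f x = 0 ∨ (4 ≤ f x ∧ f x ≤ K)) ∧ ∑ x ∈ S, f x = s := by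
    intro S
    induction S using Finset.induction_on with
    | empty => intro s h4 hs; simp at hs; omega
    | insert x S hx ih =>
      intro s h4 hs
      rw [Finset.card_insert_of_notMem hx, mul_add, mul_one] at hs
      by_cases hsK : s ≤ K
      · refine ⟨Pi.single x s, fun y => ?_, ?_⟩
        · by_cases h : y = x
          · subst h; right; simpa using ⟨h4, hsK⟩
          · left; simp [h]
        · simp
      · obtain ⟨y, hy4, hyK, hy⟩ : ∃ y, 4 ≤ y ∧ y ≤ K ∧ y + 4 ≤ s ∧ s - y ≤ K * S.card := by
          by_cases h : K + 4 ≤ s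
          · exact ⟨K, by omega, le_rfl, h, by omega⟩
          -- Taking `K` would leave a remainder of 1, 2 or 3. Taking `K - 3`, which is at least 4 as
          -- `K ≥ 7`, leaves 4, 5 or 6.
          · refine ⟨K - 3, by omega, by omega, by omega, ?_⟩
            have : 1 ≤ S.card := by
              by_contra! h0
              rw [Nat.lt_one_iff.mp h0] at hs
              omega
            have := Nat.mul_le_mul_left K this
            omega
        obtain ⟨f, hf, hfs⟩ := ih (s - y) (by omega) hy.2
        refine ⟨Function.update f x y, fun z => ?_, ?_⟩
        · by_cases h : z = x
          · subst h; right; simpa using ⟨hy4, hyK⟩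
          · simpa [h] using hf z
        · rw [Finset.sum_insert hx, Function.update_self, Finset.sum_congr rfl
            (g := f) fun z hz => Function.update_of_ne (by rintro rfl; exact hx hz) _ _, hfs]
          omega
  exact main Finset.univ s h4 (by simpa using hs)

theorem mainTheorem10 (N : ℕ) (hN : 3 ≤ N) (d : Fin N → ℕ) (hd : Antitone d)
    (hd1 : 10 ≤ d ⟨0, by omega⟩) (hd2 : 4 ≤ d ⟨1, by omega⟩) (s : ℕ) (hs : 4 ≤ s)
    (hs' : s ≤ (d ⟨0, by omega⟩ - 8) * (d ⟨1, by omega⟩ - 1) *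
      ∏ i ∈ Finset.univ.filter (fun i : Fin N => 2 ≤ (i : ℕ)), d i) :
    HasUPBWithMissingNumber d s := by
  obtain ⟨M, rfl⟩ := Nat.exists_eq_add_of_le' (by omega : 2 ≤ N)
  have hprod : ∏ i ∈ Finset.univ.filter (fun i : Fin (M + 2) => 2 ≤ (i : ℕ)), d i =
      Fintype.card ((i : Fin M) → Fin (d i.succ.succ)) := by
    rw [Finset.prod_filter, Fin.prod_univ_succ, Fin.prod_univ_succ]
    simp
  rw [hprod] at hs'
  change s ≤ (d 0 - 8) * (d 1 - 1) * _ at hs'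
  change 10 ≤ d 0 at hd1
  change 4 ≤ d 1 at hd2
  -- The product `(d 0 - 8) * (d 1 - 1)` can be as small as 6, hence the maximum with 7; the `4 × 4`
  -- families cover values up to 7.
  obtain ⟨f, hf, rfl⟩ := exists_sum_eq_of_le (κ := (i : Fin M) → Fin (d i.succ.succ))
    (K := max 7 ((d 0 - 8) * (d 1 - 1))) (le_max_left _ _) hs
    (hs'.trans (Nat.mul_le_mul_right _ (le_max_right _ _)))
  refine hasUPBWithMissingNumber_sum f (fun x => ?_) (by omega)
  rcases hf x with h | ⟨h4, hK⟩
  · rw [h]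
    exact BipartiteMissing.zero _ _
  · rcases le_max_iff.mp hK with h | h
    · exact (bipartiteMissing_four_four h4 h).mono (by omega) hd2
    · exact bipartiteMissing_of_le hd1 hd2 h4 h
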